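/- For $n\ge 1$, choose a rooted labeled tree $T$ on $n$ vertices (a tree with vertex set $\{1,\dots,n\}$ together with a distinguished vertex, the root) uniformly at random. Let $H(T)$ be its total height, i.e. the sum over all vertices of the distance to the root. Put $$W_n := \frac{n!}{n^{n-1}}\sum_{k=0}^{n-2}\frac{n^k}{k!},\qquad J_n(y):=\sum_T y^{H(T)},$$ where the last sum is over all rooted labeled trees on $n$ vertices. Then for every integer $r\ge 0$ there are polynomials $P_r,F_r,C_r\in\mathbb{Q}[a,b]$, depending only on $r$ and not on $n$, such that for all $n\ge 1$: 1. the $r$-th moment satisfies $\mathbb{E}[H^r]=P_r(n,W_n)$; 2. the $r$-th factorial moment satisfies $\mathbb{E}[H(H-1)\cdots(H-r+1)]=F_r(n,W_n)$, and $J_n^{(r)}(1)=n^{n-1}F_r(n,W_n)$; 3. the $r$-th moment about the mean satisfies $\mathbb{E}\big[(H-\mathbb{E}[H])^r\big]=C_r(n,W_n)$. -/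

import Mathlib

/-- A rooted labeled tree on the label set `Fin n`: a tree (connected acyclic graph) with a
distinguished vertex, the root. -/
structure RootedLabeledTree (n : ℕ) where
  graph : SimpleGraph (Fin n)
  root : Fin n
  isTree : graph.IsTree

namespace RootedLabeledTree

instance instFinite (n : ℕ) : Finite (RootedLabeledTree n) :=
  Finite.of_injective (fun T : RootedLabeledTree n => (T.graph, T.root)) (by
    rintro ⟨G, v, hG⟩ ⟨H, w, hH⟩ h
    simp only [Prod.mk.injEq] at h
    obtain ⟨rfl, rfl⟩ := h
    rfl)

noncomputable instance instFintype (n : ℕ) : Fintype (RootedLabeledTree n) :=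
  Fintype.ofFinite _

/-- The height of a vertex is its distance to the root; the total height is the sum of the
heights of all vertices. -/
noncomputable def totalHeight {n : ℕ} (T : RootedLabeledTree n) : ℕ :=
  ∑ v : Fin n, T.graph.dist T.root v

/-- Expectation of a rational random variable on the rooted labeled trees on `n` vertices, each
tree being equally likely. -/
noncomputable def expectation (n : ℕ) (f : RootedLabeledTree n → ℚ) : ℚ :=
  (∑ T : RootedLabeledTree n, f T) / (Fintype.card (RootedLabeledTree n) : ℚ)

/-- The `r`-th moment of the total height. -/
noncomputable def moment (n r : ℕ) : ℚ :=
  expectation n fun T => (T.totalHeight : ℚ) ^ r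

/-- The `r`-th factorial moment of the total height: the expectation of
`H (H - 1) ⋯ (H - r + 1)`. -/
noncomputable def factorialMoment (n r : ℕ) : ℚ :=
  expectation n fun T => (T.totalHeight.descFactorial r : ℚ)

/-- The `r`-th moment about the mean of the total height. -/
noncomputable def centralMoment (n r : ℕ) : ℚ :=
  expectation n fun T => ((T.totalHeight : ℚ) - moment n 1) ^ r

/-- The weight enumerator `J_n(y) = ∑_T y ^ totalHeight(T)`. -/
noncomputable def weightEnumerator (n : ℕ) : Polynomial ℚ :=
  ∑ T : RootedLabeledTree n, Polynomial.X ^ T.totalHeight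

/-- `W_n = (n! / n^(n-1)) ∑_{k=0}^{n-2} n^k / k!`, for `n ≥ 1` (the sum is empty for `n = 1`). -/
def W (n : ℕ) : ℚ :=
  (n.factorial : ℚ) / (n : ℚ) ^ (n - 1) *
    ∑ k ∈ Finset.range (n - 1), (n : ℚ) ^ k / (k.factorial : ℚ)

end RootedLabeledTree

/-! Let T(x, y) be the exponential generating function of rooted trees by total height
(`treeSeries`). Hanging a tree on a new root raises each of its vertices by one level, so T(x, y) =
x exp(T(xy, y)) (`treeSeries_eq_exp`). It is obtained by counting parent choices level by level
(`card_filter_dist`, `levelSum_succ`) and passing to the limit in the height bound.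

Put y = 1 + q. The coefficient of q^r is the series H_r of the sums of binomial coefficients "H
choose r" (`heightSeries`). With T = H_0 and u = 1/(1 - T), differentiating the functional equation
in q gives an equation linear in H_{r+1}, with leading factor 1 - T and other terms built from lower
H_k and the Euler operator θ = x d/dx. Since θT = u - 1 and θu = u^3 - u^2, the algebra ℚ[u] is
closed under θ, and induction puts every H_r with r ≥ 1 in ℚ[u] (`heightSeries_mem`).

Finally, n!/n^(n-1) times the n-th coefficient of u^k is a polynomial in n and W_n: θ multiplies
that coefficient by n, u^2 - u produces n + W_n, and θ(u^k) = k(u^(k+2) - u^(k+1)) reaches all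
higher powers (`isPolyCoeff_invSeries_pow`). Ordinary and central moments are polynomial
combinations of factorial moments. -/

namespace RootedLabeledTree

open Finset

/-! ### Trees from parent functions -/

section ParentGraph

variable {V : Type*} {r : V} {h : V → ℕ} {p : V → V}

/-- The graph joining every vertex to its parent. -/
def parentGraph (p : V → V) : SimpleGraph V := SimpleGraph.fromRel fun a b => p a = b

/-- `p` is a parent function for the height function `h` with respect to the root `r`. -/
structure IsParent (r : V) (h : V → ℕ) (p : V → V) : Prop where
  root : p r = r
  height_root : h r = 0
  height : ∀ v, v ≠ r → h (p v) + 1 = h v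

lemma IsParent.adj (H : IsParent r h p) {v : V} (hv : v ≠ r) : (parentGraph p).Adj v (p v) := by
  have := H.height v hv
  refine (SimpleGraph.fromRel_adj _ _ _).2 ⟨?_, Or.inl rfl⟩
  intro e
  rw [← e] at this
  omega

lemma IsParent.adj_iff (H : IsParent r h p) {a b : V} :
    (parentGraph p).Adj a b ↔ (a ≠ r ∧ p a = b) ∨ (b ≠ r ∧ p b = a) := by
  constructor
  · intro hab
    obtain ⟨hne, e | e⟩ := (SimpleGraph.fromRel_adj _ _ _).1 hab
    · refine Or.inl ⟨?_, e⟩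
      rintro rfl
      exact hne (H.root ▸ e)
    · refine Or.inr ⟨?_, e⟩
      rintro rfl
      exact hne (H.root ▸ e).symm
  · rintro (⟨ha, rfl⟩ | ⟨hb, rfl⟩)
    · exact H.adj ha
    · exact (H.adj hb).symm

lemma IsParent.exists_walk (H : IsParent r h p) (n : ℕ) :
    ∀ v, h v = n → ∃ w : (parentGraph p).Walk v r, w.length = n := by
  induction n with
  | zero =>
    intro v hv
    have : v = r := by
      by_contra hne
      have := H.height v hne
      omega
    subst this
    exact ⟨.nil, rfl⟩
  | succ n ih =>
    intro v hv
    have hne : v ≠ r := by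
      rintro rfl
      rw [H.height_root] at hv
      omega
    obtain ⟨w, hw⟩ := ih (p v) (by have := H.height v hne; omega)
    exact ⟨.cons (H.adj hne) w, by simp [hw]⟩

/-- Each edge changes the height by exactly one. Taking `b = r` gives the lower bound on distances
to the root. -/
lemma IsParent.le_add_length (H : IsParent r h p) {a b : V} (w : (parentGraph p).Walk a b) :
    h a ≤ h b + w.length := by
  induction w with
  | nil => simp
  | cons hab w ih =>
    rw [SimpleGraph.Walk.length_cons]
    obtain ⟨hn, rfl⟩ | ⟨hn, rfl⟩ := H.adj_iff.1 hab
    · have := H.height _ hn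
      omega
    · have := H.height _ hn
      omega

lemma IsParent.connected (H : IsParent r h p) : (parentGraph p).Connected := by
  have key : ∀ v, (parentGraph p).Reachable v r := fun v => (H.exists_walk _ v rfl).choose.reachable
  have : Nonempty V := ⟨r⟩
  exact ⟨fun a b => (key a).trans (key b).symm⟩

lemma IsParent.dist_eq (H : IsParent r h p) (v : V) : (parentGraph p).dist r v = h v := by
  rw [SimpleGraph.dist_comm]
  apply le_antisymm
  · obtain ⟨w, hw⟩ := H.exists_walk _ v rfl
    exact hw ▸ SimpleGraph.dist_le w
  · obtain ⟨w, hw⟩ := H.connected.exists_walk_length_eq_dist v r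
    have := H.le_add_length w
    rw [H.height_root] at this
    omega

/-- The non-root vertices map onto the edges by `v ↦ s(v, p v)`, so this connected graph has at most
`|V| - 1` edges. -/
lemma IsParent.isTree [Finite V] (H : IsParent r h p) : (parentGraph p).IsTree := by
  classical
  have := Fintype.ofFinite V
  refine SimpleGraph.isTree_iff_connected_and_card.2 ⟨H.connected, le_antisymm ?_
    H.connected.card_vert_le_card_edgeSet_add_one⟩
  have hcard : Nat.card {v // v ≠ r} + 1 = Nat.card V := by
    have : 0 < Fintype.card V := Fintype.card_pos_iff.2 ⟨r⟩
    simp only [ne_eq, Nat.card_eq_fintype_card, Fintype.card_subtype_compl,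
      Fintype.card_unique]
    omega
  rw [← hcard, add_le_add_iff_right]
  refine Nat.card_le_card_of_surjective
    (fun v : {v // v ≠ r} => (⟨s(v.1, p v.1), H.adj v.2⟩ : (parentGraph p).edgeSet)) ?_
  rintro ⟨e, he⟩
  induction e with
  | _ a b =>
    obtain ⟨hn, hp⟩ | ⟨hn, hp⟩ := H.adj_iff.1 he
    · exact ⟨⟨a, hn⟩, by simp [hp]⟩
    · exact ⟨⟨b, hn⟩, by simp [hp, Sym2.eq_swap]⟩

/-- A tree is the parent graph of any function choosing, for each vertex, a neighbour closer to
the root. -/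
lemma IsParent.eq_parentGraph [Finite V] {G : SimpleGraph V} (hG : G.IsTree)
    (H : IsParent r h p) (hadj : ∀ v, v ≠ r → G.Adj v (p v)) : parentGraph p = G := by
  have hle : parentGraph p ≤ G := by
    intro a b hab
    obtain ⟨hn, rfl⟩ | ⟨hn, rfl⟩ := H.adj_iff.1 hab
    · exact hadj a hn
    · exact (hadj b hn).symm
  -- Two trees on the same vertices have equally many edges, so the inclusion of edge sets is an
  -- equality.
  have h1 := (SimpleGraph.isTree_iff_connected_and_card.1 hG).2
  have h2 := (SimpleGraph.isTree_iff_connected_and_card.1 H.isTree).2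
  have hsub : (parentGraph p).edgeSet ⊆ G.edgeSet := SimpleGraph.edgeSet_mono hle
  refine SimpleGraph.edgeSet_injective (Set.eq_of_subset_of_ncard_le hsub ?_ (Set.toFinite _))
  rw [← Nat.card_coe_set_eq, ← Nat.card_coe_set_eq]
  omega

end ParentGraph

/-! ### Counting trees with prescribed heights -/

section Levels

variable {n : ℕ}

lemma ext_graph_root {T T' : RootedLabeledTree n} (hg : T.graph = T'.graph)
    (hr : T.root = T'.root) : T = T' := by
  cases T
  cases T'
  simp_all

/-- For a tree, there is a parent function for the distance to the root. -/
lemma exists_isParent (T : RootedLabeledTree n) :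
    ∃ p : Fin n → Fin n, IsParent T.root (T.graph.dist T.root) p ∧ parentGraph p = T.graph := by
  classical
  have key : ∀ v, v ≠ T.root → ∃ w, T.graph.Adj v w ∧
      T.graph.dist T.root w + 1 = T.graph.dist T.root v := by
    intro v hv
    obtain ⟨w, hw⟩ := T.isTree.connected.exists_walk_length_eq_dist v T.root
    cases w with
    | nil => exact absurd rfl hv
    | @cons _ b _ hab q =>
      refine ⟨b, hab, ?_⟩
      rw [SimpleGraph.Walk.length_cons] at hw
      have h1 : T.graph.dist b T.root ≤ q.length := SimpleGraph.dist_le q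
      have h2 := T.isTree.connected.dist_triangle (u := v) (v := b) (w := T.root)
      rw [SimpleGraph.dist_eq_one_iff_adj.2 hab] at h2
      rw [SimpleGraph.dist_comm, SimpleGraph.dist_comm (u := T.root) (v := v)]
      omega
  choose! f hf using key
  have H : IsParent T.root (T.graph.dist T.root) (fun v => if v = T.root then T.root else f v) :=
    ⟨by simp, by simp, fun v hv => by simpa [hv] using (hf v hv).2⟩
  exact ⟨_, H, H.eq_parentGraph T.isTree fun v hv => by simpa [hv] using (hf v hv).1⟩

/-- The number of trees with given root and heights. -/
lemma card_filter_dist (r : Fin n) (h : Fin n → ℕ) (hr : h r = 0) :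
    #{T : RootedLabeledTree n | T.root = r ∧ T.graph.dist T.root = h} =
      ∏ v ∈ univ.erase r, #{w | h w + 1 = h v} := by
  classical
  have hpi : #(Fintype.piFinset fun v : Fin n =>
      if v = r then ({r} : Finset (Fin n)) else ({w | h w + 1 = h v} : Finset (Fin n))) =
      ∏ v ∈ univ.erase r, #{w | h w + 1 = h v} := by
    rw [Fintype.card_piFinset, ← mul_prod_erase univ _ (mem_univ r)]
    simp only [if_true, card_singleton, one_mul]
    exact prod_congr rfl fun v hv => by rw [if_neg (ne_of_mem_erase hv)]
  have hmem : ∀ p : Fin n → Fin n, p ∈ Fintype.piFinset (fun v : Fin n =>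
      if v = r then ({r} : Finset (Fin n)) else ({w | h w + 1 = h v} : Finset (Fin n))) ↔
      IsParent r h p := by
    intro p
    rw [Fintype.mem_piFinset]
    constructor
    · intro hp
      refine ⟨by simpa using hp r, hr, fun v hv => ?_⟩
      simpa [hv] using hp v
    · intro H v
      by_cases hv : v = r
      · subst hv
        simp [H.root]
      · simp [hv, H.height v hv]
  rw [← hpi]
  symm
  refine card_bij (fun p hp => ⟨parentGraph p, r, ((hmem p).1 hp).isTree⟩) ?_ ?_ ?_
  · intro p hp
    simp only [mem_filter, mem_univ, true_and]
    exact funext ((hmem p).1 hp).dist_eq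
  · intro p hp q hq hpq
    have hg : parentGraph p = parentGraph q := congrArg RootedLabeledTree.graph hpq
    have Hp := (hmem p).1 hp
    have Hq := (hmem q).1 hq
    funext v
    by_cases hv : v = r
    · rw [hv, Hp.root, Hq.root]
    · have hadj := Hp.adj hv
      rw [hg, Hq.adj_iff] at hadj
      obtain ⟨-, h1⟩ | ⟨hn, h1⟩ := hadj
      · exact h1.symm
      -- Here `v` would be the `q`-parent of `p v`, hence lower than `p v`, although `p v` lies
      -- below `v`.
      · have h2 := Hq.height _ hn
        have h3 := Hp.height _ hv
        rw [h1] at h2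
        omega
  · intro T hT
    simp only [mem_filter, mem_univ, true_and] at hT
    obtain ⟨hTr, hTh⟩ := hT
    obtain ⟨p, hp, hg⟩ := exists_isParent T
    rw [hTr, ← hTr, hTh, hTr] at hp
    exact ⟨p, (hmem p).2 hp, ext_graph_root hg hTr.symm⟩

end Levels

/-! ### Level-by-level recursion for forests -/

section LevelSum

variable {V : Type*} [Fintype V] [DecidableEq V] {R : Type*} [CommRing R]

/-- Height functions supported on `S`, with values between `1` and `N` there. -/
def heights (S : Finset V) (N : ℕ) : Finset (V → ℕ) :=
  Fintype.piFinset fun v => if v ∈ S then Icc 1 N else {0}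

lemma mem_heights {S : Finset V} {N : ℕ} {h : V → ℕ} :
    h ∈ heights S N ↔ ∀ v, (v ∈ S → 1 ≤ h v ∧ h v ≤ N) ∧ (v ∉ S → h v = 0) := by
  rw [heights, Fintype.mem_piFinset]
  refine forall_congr' fun v => ?_
  by_cases hv : v ∈ S <;> simp [hv]

/-- The number of ways to choose parents on `S` compatible with `h`, with `m` vertices at
level zero. -/
def parentCount (S : Finset V) (m : ℕ) (h : V → ℕ) : ℕ :=
  ∏ v ∈ S, if h v = 1 then m else #{w ∈ S | h w + 1 = h v}

/-- The weight enumerator of forests on `S` of height at most `N` attached to `m` roots. -/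
def levelSum (y : R) (S : Finset V) (N m : ℕ) : R :=
  ∑ h ∈ heights S N, y ^ (∑ v ∈ S, h v) * (parentCount S m h : R)

/-- The weight enumerator of forests of height at most `N` on `s` vertices attached to `m`
roots. -/
def forestEnumerator (y : R) : ℕ → ℕ → ℕ → R
  | 0, s, _ => if s = 0 then 1 else 0
  | N + 1, s, m => y ^ s * ∑ j ∈ range (s + 1),
      (s.choose j : R) * ((m : R) ^ j * forestEnumerator y N (s - j) j)

lemma levelSum_zero (y : R) (S : Finset V) (m : ℕ) :
    levelSum y S 0 m = if #S = 0 then 1 else 0 := by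
  rcases S.eq_empty_or_nonempty with rfl | ⟨v, hv⟩
  · simp [levelSum, heights, parentCount]
  · have : heights S 0 = ∅ := by
      refine eq_empty_of_forall_notMem fun h hh => ?_
      have := (mem_heights.1 hh v).1 hv
      omega
    rw [levelSum, this, sum_empty, if_neg (card_ne_zero_of_mem hv)]

lemma parentCount_of_filter {S : Finset V} {m N : ℕ} {h : V → ℕ} (hh : h ∈ heights S N) :
    parentCount S m h = m ^ #{v ∈ S | h v = 1} *
      parentCount (S \ {v ∈ S | h v = 1}) #{v ∈ S | h v = 1} (fun v => h v - 1) := by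
  have hsd : S \ {v ∈ S | h v = 1} = {v ∈ S | ¬ h v = 1} := by
    ext v
    simp only [mem_sdiff, mem_filter]
    tauto
  rw [parentCount, ← prod_filter_mul_prod_filter_not S (fun v => h v = 1), parentCount, hsd]
  congr 1
  · rw [prod_congr rfl (g := fun _ => m), prod_const]
    intro v hv
    rw [if_pos (mem_filter.1 hv).2]
  · refine prod_congr rfl fun v hv => ?_
    obtain ⟨hvS, hv1⟩ := mem_filter.1 hv
    have h1 := (mem_heights.1 hh v).1 hvS
    rw [if_neg hv1]
    split_ifs with h2
    · congr 1
      refine filter_congr fun w _ => ?_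
      omega
    · congr 1
      ext w
      simp only [mem_filter]
      constructor
      · rintro ⟨hw, e⟩
        have := (mem_heights.1 hh w).1 hw
        exact ⟨⟨hw, by omega⟩, by omega⟩
      · rintro ⟨⟨hw, hw1⟩, e⟩
        have := (mem_heights.1 hh w).1 hw
        exact ⟨hw, by omega⟩

/-- Sort height functions by their first level `S₁`. Its vertices choose among the `m` roots and
then serve as roots for the rest, whose heights drop by one. Lowering all of `S` by one level
accounts for `y ^ #S`. -/
lemma levelSum_succ (y : R) (S : Finset V) (N m : ℕ) :
    levelSum y S (N + 1) m = y ^ #S * ∑ S₁ ∈ S.powerset,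
      ((m : R) ^ #S₁ * levelSum y (S \ S₁) N #S₁) := by
  rw [levelSum, ← sum_fiberwise_of_maps_to (s := heights S (N + 1)) (t := S.powerset)
    (g := fun h => {v ∈ S | h v = 1}) (fun h _ => mem_powerset.2 (filter_subset _ _)), mul_sum]
  refine sum_congr rfl fun S₁ hS₁ => ?_
  rw [mem_powerset] at hS₁
  rw [levelSum, mul_sum, mul_sum]
  refine sum_bij' (fun h _ v => h v - 1) (fun h _ v => if v ∈ S then h v + 1 else 0) ?_ ?_ ?_ ?_ ?_
  · intro h hh
    obtain ⟨hk, rfl⟩ := mem_filter.1 hh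
    refine mem_heights.2 fun v => ?_
    have := mem_heights.1 hk v
    simp only [mem_sdiff, mem_filter]
    by_cases hv : v ∈ S
    · have := this.1 hv
      simp only [hv, true_and, not_not]
      exact ⟨fun _ => by omega, fun _ => by omega⟩
    · have := this.2 hv
      simp only [hv, false_and, false_implies, true_and]
      omega
  · intro h hh
    rw [mem_heights] at hh
    rw [mem_filter, mem_heights]
    refine ⟨fun v => ?_, ?_⟩
    · by_cases hv : v ∈ S
      · simp only [hv, if_true, not_true, false_implies, and_true, true_implies]
        by_cases hv1 : v ∈ S₁
        · have := (hh v).2 (by simp [hv1])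
          omega
        · have := (hh v).1 (by simp [hv, hv1])
          omega
      · simp [hv]
    · ext v
      simp only [mem_filter]
      by_cases hv : v ∈ S
      · by_cases hv1 : v ∈ S₁
        · have := (hh v).2 (by simp [hv1])
          simp [hv, hv1, this]
        · have := (hh v).1 (by simp [hv, hv1])
          simp only [hv, hv1, if_true, true_and, iff_false]
          omega
      · simp only [hv, false_and, false_iff]
        exact fun h1 => hv (hS₁ h1)
  · intro h hh
    obtain ⟨hk, -⟩ := mem_filter.1 hh
    funext v
    have := mem_heights.1 hk v
    by_cases hv : v ∈ S
    · have := this.1 hv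
      simp only [hv, if_true]
      omega
    · have := this.2 hv
      simp [hv, this]
  · intro h hh
    rw [mem_heights] at hh
    funext v
    by_cases hv : v ∈ S
    · simp [hv]
    · simpa [hv] using ((hh v).2 (by simp [hv])).symm
  · intro h hh
    obtain ⟨hk, rfl⟩ := mem_filter.1 hh
    rw [parentCount_of_filter hk]
    have hsum : ∑ v ∈ S, h v = #S + ∑ v ∈ S \ {v ∈ S | h v = 1}, (h v - 1) := by
      have h1 : ∑ v ∈ S, h v = ∑ v ∈ S, (1 + (h v - 1)) := by
        refine sum_congr rfl fun v hv => ?_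
        have := (mem_heights.1 hk v).1 hv
        omega
      have h2 : ∑ v ∈ S \ {v ∈ S | h v = 1}, (h v - 1) = ∑ v ∈ S, (h v - 1) := by
        refine sum_subset sdiff_subset fun v hv hv' => ?_
        simp only [mem_sdiff, mem_filter, hv, true_and, not_not] at hv'
        omega
      rw [h1, sum_add_distrib, h2]
      simp
    rw [hsum, pow_add]
    push_cast
    ring

lemma levelSum_eq_forestEnumerator (y : R) (N : ℕ) : ∀ (S : Finset V) (m : ℕ),
    levelSum y S N m = forestEnumerator y N #S m := by
  induction N with
  | zero => intro S m; rw [levelSum_zero, forestEnumerator]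
  | succ N ih =>
    intro S m
    rw [levelSum_succ, forestEnumerator]
    congr 1
    rw [sum_congr rfl (g := fun S₁ => (fun j => (m : R) ^ j * forestEnumerator y N (#S - j) j) #S₁),
      sum_powerset_apply_card (fun j => (m : R) ^ j * forestEnumerator y N (#S - j) j)]
    · simp only [nsmul_eq_mul]
    · intro S₁ hS₁
      rw [ih, card_sdiff_of_subset (mem_powerset.1 hS₁)]

/-- Weight enumerator of rooted labeled trees in terms of forests. -/
theorem sum_pow_totalHeight (y : R) (s N : ℕ) (hN : s ≤ N) :
    ∑ T : RootedLabeledTree (s + 1), y ^ T.totalHeight =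
      (s + 1 : R) * forestEnumerator y N s 1 := by
  classical
  have hroot : ∀ r : Fin (s + 1), ∑ T : RootedLabeledTree (s + 1) with T.root = r,
      y ^ T.totalHeight = forestEnumerator y N s 1 := by
    intro r
    have hcard : #((univ : Finset (Fin (s + 1))).erase r) = s := by simp
    conv_rhs => rw [← hcard, ← levelSum_eq_forestEnumerator, levelSum]
    rw [← sum_fiberwise_of_maps_to (t := heights (univ.erase r) N)
      (g := fun T => T.graph.dist T.root)]
    · refine sum_congr rfl fun h hh => ?_
      have hr : h r = 0 := (mem_heights.1 hh r).2 (by simp)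
      rw [filter_filter, sum_congr rfl (g := fun _ => y ^ (∑ v ∈ univ.erase r, h v)), sum_const,
        card_filter_dist r h hr, nsmul_eq_mul, mul_comm]
      · congr 2
        rw [parentCount]
        refine prod_congr rfl fun v hv => ?_
        have hv1 := (mem_heights.1 hh v).1 hv
        split_ifs with h1
        · rw [h1, card_eq_one]
          refine ⟨r, ?_⟩
          ext w
          simp only [mem_filter, mem_univ, true_and, mem_singleton]
          constructor
          · intro hw
            by_contra hne
            have := (mem_heights.1 hh w).1 (by simp [hne])
            omega
          · rintro rfl
            omega
        · congr 1
          ext w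
          simp only [mem_filter, mem_univ, true_and, mem_erase, and_true]
          constructor
          · intro hw
            refine ⟨?_, hw⟩
            rintro rfl
            omega
          · exact fun hw => hw.2
      · intro T hT
        obtain ⟨-, -, hTh⟩ := mem_filter.1 hT
        rw [totalHeight, hTh, ← add_sum_erase univ h (mem_univ r), hr, zero_add]
    · intro T hT
      obtain ⟨-, rfl⟩ := mem_filter.1 hT
      refine mem_heights.2 fun v => ⟨fun hv => ⟨?_, ?_⟩, fun hv => ?_⟩
      · exact T.isTree.connected.pos_dist_of_ne (ne_of_mem_erase hv).symm
      · obtain ⟨w, hw, hl⟩ := T.isTree.connected.exists_path_of_dist T.root v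
        have := hw.length_lt
        rw [Fintype.card_fin] at this
        omega
      · have : v = T.root := by simpa using hv
        simp [this]
  rw [← sum_fiberwise_of_maps_to (s := univ) (t := univ) (g := fun T => T.root)
    (fun _ _ => mem_univ _), sum_congr rfl fun r _ => hroot r]
  simp

end LevelSum

open PowerSeries

/-! ### Substitution and derivations of power series -/

section Series

variable {R : Type*} [CommRing R]

lemma coeff_subst_eq_sum {Z : R⟦X⟧} (hZ : constantCoeff Z = 0) (f : R⟦X⟧) {s N : ℕ}
    (hs : s < N) : coeff s (f.subst Z) = ∑ j ∈ range N, coeff j f * coeff s (Z ^ j) := by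
  rw [coeff_subst' (HasSubst.of_constantCoeff_zero' hZ)]
  simp only [smul_eq_mul]
  refine finsum_eq_sum_of_support_subset _ fun j hj => ?_
  rw [coe_range, Set.mem_Iio]
  by_contra hlt
  refine hj ?_
  have hdvd : (X : R⟦X⟧) ^ j ∣ Z ^ j := pow_dvd_pow_of_dvd (X_dvd_iff.2 hZ) j
  simp only [X_pow_dvd_iff.1 hdvd s (by omega), mul_zero]

lemma eq_of_forall_X_pow_dvd_sub {f g : R⟦X⟧} (h : ∀ N, (X : R⟦X⟧) ^ N ∣ f - g) : f = g := by
  ext s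
  have := X_pow_dvd_iff.1 (h (s + 1)) s (Nat.lt_succ_self s)
  rwa [map_sub, sub_eq_zero] at this

lemma X_pow_dvd_subst_sub_subst {Z Z' : R⟦X⟧} (hZ : constantCoeff Z = 0)
    (hZ' : constantCoeff Z' = 0) {N : ℕ} (h : (X : R⟦X⟧) ^ N ∣ Z - Z') (f : R⟦X⟧) :
    (X : R⟦X⟧) ^ N ∣ f.subst Z - f.subst Z' := by
  refine X_pow_dvd_iff.2 fun s hs => ?_
  rw [map_sub, coeff_subst_eq_sum hZ f hs, coeff_subst_eq_sum hZ' f hs, ← sum_sub_distrib]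
  refine sum_eq_zero fun j _ => ?_
  rw [← mul_sub, ← map_sub, X_pow_dvd_iff.1 (h.trans (sub_dvd_pow_sub_pow Z Z' j)) s hs, mul_zero]

lemma X_pow_dvd_rescale {f : R⟦X⟧} {N : ℕ} (h : (X : R⟦X⟧) ^ N ∣ f) (y : R) :
    (X : R⟦X⟧) ^ N ∣ rescale y f := by
  refine X_pow_dvd_iff.2 fun s hs => ?_
  rw [coeff_rescale, X_pow_dvd_iff.1 h s hs, mul_zero]

variable [Algebra ℚ R]

/-- A derivation of power series that does not lower the order satisfies the chain rule for the
exponential series. -/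
lemma derivation_exp_subst (δ : Derivation ℚ R⟦X⟧ R⟦X⟧)
    (hδ : ∀ (N : ℕ) (f : R⟦X⟧), X ^ N ∣ f → X ^ N ∣ δ f) {Z : R⟦X⟧} (hZ : constantCoeff Z = 0) :
    δ ((exp R).subst Z) = (exp R).subst Z * δ Z := by
  set E := (exp R).subst Z with hE
  let P : ℕ → R⟦X⟧ := fun N => ∑ j ∈ range N, (1 / (j.factorial : ℚ)) • Z ^ j
  have happrox : ∀ N, (X : R⟦X⟧) ^ N ∣ E - P N := by
    intro N
    refine X_pow_dvd_iff.2 fun s hs => ?_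
    rw [map_sub, hE, coeff_subst_eq_sum hZ _ hs, map_sum, ← sum_sub_distrib]
    refine sum_eq_zero fun j _ => ?_
    rw [coeff_exp, sub_eq_zero, ← Algebra.smul_def]
    rfl
  have hP : ∀ N, δ (P (N + 1)) = P N * δ Z := by
    intro N
    simp only [P]
    rw [sum_range_succ', map_add, map_sum, sum_mul]
    rw [pow_zero, Derivation.map_smul, Derivation.map_one_eq_zero, smul_zero, add_zero]
    refine sum_congr rfl fun j _ => ?_
    rw [Derivation.map_smul, Derivation.leibniz_pow, add_tsub_cancel_right, smul_eq_mul, smul_mul_assoc,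
      ← Nat.cast_smul_eq_nsmul ℚ (j + 1) (Z ^ j * δ Z), smul_smul]
    congr 1
    rw [Nat.factorial_succ]
    have : (j.factorial : ℚ) ≠ 0 := by positivity
    push_cast
    field_simp
  refine eq_of_forall_X_pow_dvd_sub fun N => ?_
  -- The truncations satisfy the chain rule with a shift of index, so the error is controlled by the
  -- two tails.
  have : δ E - E * δ Z = δ (E - P (N + 1)) - (E - P N) * δ Z := by
    rw [map_sub, hP]
    ring
  rw [this]
  exact dvd_sub ((pow_dvd_pow X (Nat.le_succ N)).trans (hδ _ _ (happrox _)))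
    (dvd_mul_of_dvd_left (happrox N) _)

/-- The derivation of power series acting coefficientwise. -/
noncomputable def coeffDerivation (d : Derivation ℚ R R) : Derivation ℚ R⟦X⟧ R⟦X⟧ :=
  Derivation.mk'
    { toFun := fun f => PowerSeries.mk fun n => d (coeff n f)
      map_add' := fun f g => by ext n; simp
      map_smul' := fun c f => by
        ext n
        rw [RingHom.id_apply, map_rat_smul (coeff n), coeff_mk, coeff_mk, map_rat_smul (coeff n),
          d.map_smul] }
    (fun f g => by
      ext n
      simp only [LinearMap.coe_mk, AddHom.coe_mk, coeff_mk, coeff_mul, map_sum, map_add,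
        smul_eq_mul, Derivation.leibniz, sum_add_distrib]
      congr 1
      rw [← Finset.Nat.sum_antidiagonal_swap]
      rfl)

@[simp] lemma coeff_coeffDerivation (d : Derivation ℚ R R) (f : R⟦X⟧) (n : ℕ) :
    coeff n (coeffDerivation d f) = d (coeff n f) := by
  simp [coeffDerivation]

lemma coeffDerivation_X_pow_dvd (d : Derivation ℚ R R) (N : ℕ) (f : R⟦X⟧) (h : X ^ N ∣ f) :
    X ^ N ∣ coeffDerivation d f := by
  refine X_pow_dvd_iff.2 fun s hs => ?_
  rw [coeff_coeffDerivation, X_pow_dvd_iff.1 h s hs, map_zero]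

variable (R) in
/-- The Euler derivation `X * d/dX`. -/
noncomputable def euler : Derivation ℚ R⟦X⟧ R⟦X⟧ :=
  Derivation.mk'
    { toFun := fun f => PowerSeries.mk fun n => (n : R) * coeff n f
      map_add' := fun f g => by ext n; simp [mul_add]
      map_smul' := fun c f => by
        ext n
        rw [RingHom.id_apply, map_rat_smul (coeff n), coeff_mk, coeff_mk, map_rat_smul (coeff n),
          mul_smul_comm] }
    (fun f g => by
      ext n
      simp only [LinearMap.coe_mk, AddHom.coe_mk, coeff_mk, coeff_mul, map_add, smul_eq_mul]
      rw [← Finset.Nat.sum_antidiagonal_swap (n := n)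
        (f := fun p => coeff p.1 g * ((p.2 : R) * coeff p.2 f)), ← sum_add_distrib, mul_sum]
      refine sum_congr rfl fun p hp => ?_
      rw [← mem_antidiagonal.1 hp]
      simp only [Prod.fst_swap, Prod.snd_swap]
      push_cast
      ring)

@[simp] lemma coeff_euler (f : R⟦X⟧) (n : ℕ) : coeff n (euler R f) = (n : R) * coeff n f := by
  simp [euler]

lemma euler_X_pow_dvd (N : ℕ) (f : R⟦X⟧) (h : X ^ N ∣ f) : X ^ N ∣ euler R f := by
  refine X_pow_dvd_iff.2 fun s hs => ?_
  rw [coeff_euler, X_pow_dvd_iff.1 h s hs, mul_zero]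

lemma euler_X : euler R (X : R⟦X⟧) = X := by
  ext n
  rw [coeff_euler, coeff_X]
  split_ifs with h <;> simp [h]

end Series

/-! ### The functional equation -/

section Forests

variable {R : Type*} [CommRing R]

lemma forestEnumerator_zero_right (y : R) (N s : ℕ) :
    forestEnumerator y N s 0 = if s = 0 then 1 else 0 := by
  induction N generalizing s with
  | zero => rfl
  | succ N ih =>
    rw [forestEnumerator, sum_eq_single 0]
    · rw [Nat.sub_zero, ih]
      split_ifs with h <;> simp [h]
    · intro j _ hj
      simp [hj]
    · simp

/-- A forest on `s` non-root vertices has height at most `s`, so a larger height bound adds nothing.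
-/
lemma forestEnumerator_succ_of_le (y : R) (N : ℕ) : ∀ s m, s ≤ N →
    forestEnumerator y (N + 1) s m = forestEnumerator y N s m := by
  induction N with
  | zero =>
    intro s m hs
    obtain rfl : s = 0 := by omega
    simp [forestEnumerator]
  | succ N ih =>
    intro s m hs
    rw [forestEnumerator, forestEnumerator]
    congr 1
    refine sum_congr rfl fun j hj => ?_
    -- For `j = 0` the vertex count does not drop and `ih` may not apply, but without roots both
    -- sides are known.
    rcases j.eq_zero_or_pos with rfl | hj0
    · rw [forestEnumerator_zero_right, forestEnumerator_zero_right]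
    · rw [ih _ _ (by omega)]

lemma forestEnumerator_of_le (y : R) {N s : ℕ} (h : s ≤ N) (m : ℕ) :
    forestEnumerator y N s m = forestEnumerator y s s m := by
  induction N, h using Nat.le_induction with
  | base => rfl
  | succ N h ih => rw [forestEnumerator_succ_of_le y N s m h, ih]

/-- The number of forests on `s` vertices attached to `m` roots is `m (m + s) ^ (s - 1)`. -/
lemma forestEnumerator_one (N : ℕ) : ∀ s m : ℕ, s ≤ N →
    ((m : ℚ) + s) * forestEnumerator (1 : ℚ) N s m = m * ((m : ℚ) + s) ^ s := by
  induction N with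
  | zero =>
    intro s m hs
    obtain rfl : s = 0 := by omega
    simp [forestEnumerator]
  | succ N ih =>
    intro s m hs
    rcases s with _ | t
    · simp [forestEnumerator, forestEnumerator_zero_right]
    -- In every inner forest, roots and remaining vertices together number `t + 1`, so this factor
    -- is what `ih` needs. Absorbing `j + 1` into the binomial coefficient leaves the expansion of
    -- `(m + (t + 1)) ^ t`.
    · have key : ((t + 1 : ℕ) : ℚ) * forestEnumerator (1 : ℚ) (N + 1) (t + 1) m =
          ((t + 1 : ℕ) : ℚ) * (m * ((m : ℚ) + (t + 1 : ℕ)) ^ t) := by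
        rw [forestEnumerator, one_pow, one_mul, sum_range_succ', forestEnumerator_zero_right]
        simp only [Nat.sub_zero, Nat.succ_ne_zero, if_false, mul_zero, add_zero]
        rw [add_pow, mul_sum, mul_sum, mul_sum]
        refine sum_congr rfl fun j hj => ?_
        have hjt : j ≤ t := Nat.lt_succ_iff.1 (mem_range.1 hj)
        have h1 := ih (t + 1 - (j + 1)) (j + 1) (by omega)
        have h2 : ((j + 1 : ℕ) : ℚ) + (t + 1 - (j + 1) : ℕ) = (t + 1 : ℕ) := by
          rw [← Nat.cast_add]
          congr 1
          omega
        have h3 : ((t + 1).choose (j + 1) : ℚ) * (j + 1 : ℕ) = (t + 1 : ℕ) * t.choose j := by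
          exact_mod_cast (Nat.add_one_mul_choose_eq t j).symm
        rw [h2] at h1
        rw [show t + 1 - (j + 1) = t - j by omega] at h1 ⊢
        calc ((t + 1 : ℕ) : ℚ) * (((t + 1).choose (j + 1) : ℚ) * ((m : ℚ) ^ (j + 1) *
              forestEnumerator 1 N (t - j) (j + 1)))
            = ((t + 1).choose (j + 1) : ℚ) * ((m : ℚ) ^ (j + 1) * (((t + 1 : ℕ) : ℚ) *
              forestEnumerator 1 N (t - j) (j + 1))) := by ring
          _ = (((t + 1).choose (j + 1) : ℚ) * (j + 1 : ℕ)) * ((m : ℚ) ^ (j + 1) *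
              ((t + 1 : ℕ) : ℚ) ^ (t - j)) := by rw [h1]; ring
          _ = _ := by rw [h3]; ring
      have ht : ((t + 1 : ℕ) : ℚ) ≠ 0 := by positivity
      rw [mul_left_cancel₀ ht key, pow_succ]
      ring

lemma constantCoeff_rescale_X_mul (y : R) (f : R⟦X⟧) :
    constantCoeff (rescale y (X * f)) = 0 := by
  rw [← coeff_zero_eq_constantCoeff_apply, coeff_rescale, coeff_zero_X_mul, mul_zero]

variable [Algebra ℚ R]

/-- Exponential generating function of forests of height at most `N` attached to `m` roots. -/
noncomputable def forestSeries (y : R) (N m : ℕ) : R⟦X⟧ :=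
  PowerSeries.mk fun s => algebraMap ℚ R (1 / s.factorial) * forestEnumerator y N s m

/-- The level recursion becomes a product of exponential series once `j` roots contribute a `j`-th
power. The sum over `j` is then exp(mZ) = exp(Z)^m, which also passes the power property on to `N +
1`. -/
lemma forestSeries_succ (y : R) (N m : ℕ)
    (h : ∀ j, forestSeries y N j = forestSeries y N 1 ^ j) :
    forestSeries y (N + 1) m =
      ((exp R).subst (rescale y (X * forestSeries y N 1))) ^ m := by
  have hZ : constantCoeff (rescale y (X * forestSeries y N 1)) = 0 := by
    rw [← coeff_zero_eq_constantCoeff_apply, coeff_rescale, coeff_zero_X_mul, mul_zero]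
  rw [← subst_pow (HasSubst.of_constantCoeff_zero' hZ), exp_pow_eq_rescale_exp]
  ext s
  rw [coeff_subst_eq_sum hZ _ (Nat.lt_succ_self s), forestSeries, coeff_mk, forestEnumerator,
    mul_left_comm, mul_sum, mul_sum]
  refine sum_congr rfl fun j hj => ?_
  have hjs : j ≤ s := Nat.lt_succ_iff.1 (mem_range.1 hj)
  rw [← map_pow, coeff_rescale, coeff_rescale, mul_pow, ← h, coeff_X_pow_mul', if_pos hjs,
    coeff_exp, forestSeries, coeff_mk]
  have hc : algebraMap ℚ R (1 / s.factorial) * (s.choose j : R) =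
      algebraMap ℚ R (1 / j.factorial) * algebraMap ℚ R (1 / (s - j).factorial) := by
    rw [← map_natCast (algebraMap ℚ R), ← map_mul, ← map_mul, Nat.cast_choose ℚ hjs]
    congr 1
    have h1 : (s.factorial : ℚ) ≠ 0 := by positivity
    have h2 : (j.factorial : ℚ) ≠ 0 := by positivity
    have h3 : ((s - j).factorial : ℚ) ≠ 0 := by positivity
    field_simp
  calc y ^ s * (algebraMap ℚ R (1 / s.factorial) * ((s.choose j : R) *
        ((m : R) ^ j * forestEnumerator y N (s - j) j)))
      = y ^ s * ((algebraMap ℚ R (1 / s.factorial) * (s.choose j : R)) *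
        ((m : R) ^ j * forestEnumerator y N (s - j) j)) := by ring
    _ = _ := by rw [hc]; ring

lemma forestSeries_eq_pow (y : R) (N m : ℕ) : forestSeries y N m = forestSeries y N 1 ^ m := by
  induction N generalizing m with
  | zero =>
    have h1 : ∀ m, forestSeries y 0 m = 1 := by
      intro m
      ext s
      rw [forestSeries, coeff_mk, forestEnumerator, coeff_one]
      split_ifs with h <;> simp [h]
    rw [h1, h1, one_pow]
  | succ N ih =>
    rw [forestSeries_succ y N m ih, forestSeries_succ y N 1 ih, pow_one]

/-- Exponential generating function of forests attached to a single root. -/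
noncomputable def forestLimit (y : R) : R⟦X⟧ :=
  PowerSeries.mk fun s => algebraMap ℚ R (1 / s.factorial) * forestEnumerator y s s 1

lemma X_pow_dvd_forestLimit_sub (y : R) (N : ℕ) :
    (X : R⟦X⟧) ^ N ∣ forestLimit y - forestSeries y N 1 := by
  refine X_pow_dvd_iff.2 fun s hs => ?_
  rw [map_sub, forestLimit, forestSeries, coeff_mk, coeff_mk, forestEnumerator_of_le y hs.le,
    sub_self]

lemma coeff_forestLimit_pow (y : R) (m s : ℕ) : coeff s (forestLimit y ^ m) =
    algebraMap ℚ R (1 / s.factorial) * forestEnumerator y s s m := by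
  have h := X_pow_dvd_iff.1 ((X_pow_dvd_forestLimit_sub y (s + 1)).trans
    (sub_dvd_pow_sub_pow _ _ m)) s (Nat.lt_succ_self s)
  rw [map_sub, sub_eq_zero] at h
  rw [h, ← forestSeries_eq_pow, forestSeries, coeff_mk, forestEnumerator_of_le y (Nat.le_succ s)]

lemma forestLimit_eq (y : R) :
    forestLimit y = (exp R).subst (rescale y (X * forestLimit y)) := by
  refine eq_of_forall_X_pow_dvd_sub fun N => ?_
  have h1 := (pow_dvd_pow X (Nat.le_succ N)).trans (X_pow_dvd_forestLimit_sub y (N + 1))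
  rw [forestSeries_succ y N 1 (forestSeries_eq_pow y N), pow_one] at h1
  refine (dvd_add h1 (X_pow_dvd_subst_sub_subst (constantCoeff_rescale_X_mul y (forestSeries y N 1))
    (constantCoeff_rescale_X_mul y (forestLimit y)) ?_ (exp R))).trans ?_
  · rw [← map_sub, ← mul_sub, ← dvd_neg, ← map_neg, ← mul_neg, neg_sub]
    exact X_pow_dvd_rescale (dvd_mul_of_dvd_right (X_pow_dvd_forestLimit_sub y N) X) y
  · rw [sub_add_sub_cancel]

/-- Exponential generating function of rooted labeled trees by total height. -/
noncomputable def treeSeries (y : R) : R⟦X⟧ :=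
  PowerSeries.mk fun n =>
    algebraMap ℚ R (1 / n.factorial) * ∑ T : RootedLabeledTree n, y ^ T.totalHeight

lemma treeSeries_eq (y : R) : treeSeries y = X * forestLimit y := by
  ext n
  rcases n with _ | s
  · have : IsEmpty (RootedLabeledTree 0) := ⟨fun T => T.root.elim0⟩
    simp [treeSeries]
  · rw [treeSeries, coeff_mk, sum_pow_totalHeight y s s le_rfl, coeff_succ_X_mul, forestLimit,
      coeff_mk, ← mul_assoc]
    congr 1
    have : (s + 1 : R) = algebraMap ℚ R (s + 1) := by simp
    rw [this, ← map_mul]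
    congr 1
    have h1 : (s.factorial : ℚ) ≠ 0 := by positivity
    rw [Nat.factorial_succ]
    push_cast
    field_simp

lemma constantCoeff_rescale_treeSeries (y : R) : constantCoeff (rescale y (treeSeries y)) = 0 := by
  rw [treeSeries_eq, constantCoeff_rescale_X_mul]

lemma treeSeries_eq_exp (y : R) :
    treeSeries y = X * (exp R).subst (rescale y (treeSeries y)) := by
  conv_lhs => rw [treeSeries_eq, forestLimit_eq, ← treeSeries_eq]

lemma coeffDerivation_treeSeries (y : R) (d : Derivation ℚ R R) :
    coeffDerivation d (treeSeries y) =
      treeSeries y * coeffDerivation d (rescale y (treeSeries y)) := by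
  have hX : coeffDerivation d (X : R⟦X⟧) = 0 := by
    ext n
    rw [coeff_coeffDerivation, coeff_X]
    split_ifs <;> simp
  conv_lhs => rw [treeSeries_eq_exp, Derivation.leibniz, hX, smul_zero, add_zero, smul_eq_mul,
    derivation_exp_subst _ (coeffDerivation_X_pow_dvd d) (constantCoeff_rescale_treeSeries y),
    ← mul_assoc, ← treeSeries_eq_exp]

lemma euler_treeSeries (y : R) : euler R (treeSeries y) =
    treeSeries y + treeSeries y * euler R (rescale y (treeSeries y)) := by
  conv_lhs => rw [treeSeries_eq_exp, Derivation.leibniz, euler_X, smul_eq_mul, smul_eq_mul,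
    derivation_exp_subst _ euler_X_pow_dvd (constantCoeff_rescale_treeSeries y),
    ← mul_assoc, mul_comm _ X, ← treeSeries_eq_exp, add_comm]

end Forests

/-! ### The Cayley tree series and u = 1/(1 - T) -/

section CayleySeries

/-- The exponential generating function of rooted labeled trees. -/
noncomputable def cayleySeries : ℚ⟦X⟧ := treeSeries (1 : ℚ)

lemma euler_cayleySeries :
    euler ℚ cayleySeries = cayleySeries + cayleySeries * euler ℚ cayleySeries := by
  have h := euler_treeSeries (1 : ℚ)
  rwa [rescale_one, RingHom.id_apply] at h

/-- The series `1 / (1 - T)`, where `T` is the series of rooted labeled trees. -/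
noncomputable def invSeries : ℚ⟦X⟧ := 1 + euler ℚ cayleySeries

lemma one_sub_mul_invSeries : (1 - cayleySeries) * invSeries = 1 := by
  rw [invSeries]
  linear_combination euler_cayleySeries

lemma euler_cayleySeries_eq : euler ℚ cayleySeries = invSeries - 1 := by
  rw [invSeries, add_sub_cancel_left]

/-- Apply θ to (1 - T)u = 1, use θT = u - 1, and multiply by u. -/
lemma euler_invSeries : euler ℚ invSeries = invSeries ^ 3 - invSeries ^ 2 := by
  have h := congrArg (euler ℚ) one_sub_mul_invSeries
  rw [Derivation.leibniz, map_sub, Derivation.map_one_eq_zero, euler_cayleySeries_eq, smul_eq_mul,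
    smul_eq_mul] at h
  linear_combination invSeries * h - euler ℚ invSeries * one_sub_mul_invSeries

lemma natCast_mul_coeff_cayleySeries_pow {n j : ℕ} (hj : j ≤ n) :
    (n : ℚ) * coeff n (cayleySeries ^ j) = j * ((n : ℚ) ^ (n - j) / (n - j).factorial) := by
  have h := forestEnumerator_one (n - j) (n - j) j le_rfl
  have hn : ((j : ℚ) + (n - j : ℕ)) = n := by
    rw [← Nat.cast_add, Nat.add_sub_cancel' hj]
  rw [hn] at h
  rw [cayleySeries, treeSeries_eq, mul_pow, coeff_X_pow_mul', if_pos hj, coeff_forestLimit_pow,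
    Algebra.algebraMap_self, RingHom.id_apply]
  linear_combination (1 / ((n - j).factorial : ℚ)) * h

lemma factorial_mul_coeff_cayleySeries {n : ℕ} (hn : 1 ≤ n) :
    (n.factorial : ℚ) * coeff n cayleySeries = (n : ℚ) ^ (n - 1) := by
  have h := natCast_mul_coeff_cayleySeries_pow hn
  rw [pow_one, Nat.cast_one, one_mul] at h
  rw [← Nat.mul_factorial_pred (by omega : n ≠ 0), Nat.cast_mul, mul_right_comm, h]
  exact div_mul_cancel₀ _ (by positivity)

/-- **Cayley's formula** for rooted trees. -/
lemma card_eq {n : ℕ} (hn : 1 ≤ n) : (Fintype.card (RootedLabeledTree n) : ℚ) =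
    (n : ℚ) ^ (n - 1) := by
  rw [← factorial_mul_coeff_cayleySeries hn, cayleySeries, treeSeries, coeff_mk,
    Algebra.algebraMap_self, RingHom.id_apply, ← mul_assoc, mul_one_div_cancel (by positivity)]
  simp

lemma X_dvd_cayleySeries : X ∣ cayleySeries := by
  rw [cayleySeries, treeSeries_eq]
  exact dvd_mul_right _ _

lemma coeff_invSeries_sq_sub {n : ℕ} :
    coeff n (invSeries ^ 2 - invSeries) = ∑ k ∈ range n, (n : ℚ) ^ k / k.factorial := by
  -- u^2 - u = u θT, with u expanded as a geometric series in T up to order `n`. The remainder has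
  -- order above `n`, and each T^j θT is θ(T^(j+1))/(j+1), whose coefficients are known.
  have hgeom : invSeries ^ 2 - invSeries =
      (∑ j ∈ range n, cayleySeries ^ j * euler ℚ cayleySeries) +
        cayleySeries ^ n * (invSeries * euler ℚ cayleySeries) := by
    have h := geom_sum_mul cayleySeries n
    rw [← sum_mul]
    linear_combination (invSeries * euler ℚ cayleySeries) * h +
      ((∑ j ∈ range n, cayleySeries ^ j) * euler ℚ cayleySeries) * one_sub_mul_invSeries -
      invSeries * euler_cayleySeries_eq
  have hX : X ∣ euler ℚ cayleySeries := by
    simpa using euler_X_pow_dvd 1 cayleySeries (by simpa using X_dvd_cayleySeries)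
  have hvanish : coeff n (cayleySeries ^ n * (invSeries * euler ℚ cayleySeries)) = 0 := by
    refine X_pow_dvd_iff.1 (?_ : X ^ (n + 1) ∣ _) n (Nat.lt_succ_self n)
    rw [pow_succ]
    exact mul_dvd_mul (pow_dvd_pow_of_dvd X_dvd_cayleySeries n) (dvd_mul_of_dvd_right hX _)
  rw [hgeom, map_add, hvanish, add_zero, map_sum, ← sum_range_reflect]
  refine sum_congr rfl fun j hj => ?_
  have hjn : j < n := mem_range.1 hj
  have h1 : euler ℚ (cayleySeries ^ (n - 1 - j + 1)) =
      ((n - 1 - j + 1 : ℕ) : ℚ⟦X⟧) * (cayleySeries ^ (n - 1 - j) * euler ℚ cayleySeries) := by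
    rw [Derivation.leibniz_pow, add_tsub_cancel_right, nsmul_eq_mul, smul_eq_mul]
  have h2 := natCast_mul_coeff_cayleySeries_pow (show n - 1 - j + 1 ≤ n by omega)
  rw [← coeff_euler, h1, ← map_natCast (C (R := ℚ)), coeff_C_mul,
    show n - (n - 1 - j + 1) = j by omega] at h2
  exact mul_left_cancel₀ (by positivity) h2

end CayleySeries

/-! ### Coefficients polynomial in n and W_n -/

section Good

/-- Power series whose `n`-th coefficient, multiplied by `n! / n ^ (n - 1)`, is a polynomial
in `n` and `W n`. -/
def IsPolyCoeff (f : ℚ⟦X⟧) : Prop :=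
  ∃ P : MvPolynomial (Fin 2) ℚ, ∀ n : ℕ, 1 ≤ n →
    (n.factorial : ℚ) * coeff n f = (n : ℚ) ^ (n - 1) * MvPolynomial.eval ![(n : ℚ), W n] P

lemma IsPolyCoeff.add {f g : ℚ⟦X⟧} (hf : IsPolyCoeff f) (hg : IsPolyCoeff g) :
    IsPolyCoeff (f + g) := by
  obtain ⟨P, hP⟩ := hf
  obtain ⟨Q, hQ⟩ := hg
  refine ⟨P + Q, fun n hn => ?_⟩
  rw [map_add, map_add, mul_add, hP n hn, hQ n hn, mul_add]

lemma IsPolyCoeff.smul {f : ℚ⟦X⟧} (hf : IsPolyCoeff f) (c : ℚ) : IsPolyCoeff (c • f) := by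
  obtain ⟨P, hP⟩ := hf
  refine ⟨MvPolynomial.C c * P, fun n hn => ?_⟩
  rw [map_mul, MvPolynomial.eval_C, map_smul, smul_eq_mul]
  linear_combination c * hP n hn

lemma IsPolyCoeff.euler {f : ℚ⟦X⟧} (hf : IsPolyCoeff f) : IsPolyCoeff (euler ℚ f) := by
  obtain ⟨P, hP⟩ := hf
  refine ⟨MvPolynomial.X 0 * P, fun n hn => ?_⟩
  rw [map_mul, MvPolynomial.eval_X, coeff_euler, Matrix.cons_val_zero]
  linear_combination (n : ℚ) * hP n hn

lemma isPolyCoeff_one : IsPolyCoeff 1 := by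
  refine ⟨0, fun n hn => ?_⟩
  rw [coeff_one, if_neg (by omega), map_zero, mul_zero, mul_zero]

lemma isPolyCoeff_cayleySeries : IsPolyCoeff cayleySeries := by
  refine ⟨1, fun n hn => ?_⟩
  rw [factorial_mul_coeff_cayleySeries hn, map_one, mul_one]

lemma isPolyCoeff_invSeries : IsPolyCoeff invSeries :=
  isPolyCoeff_one.add isPolyCoeff_cayleySeries.euler

lemma isPolyCoeff_invSeries_sq : IsPolyCoeff (invSeries ^ 2) := by
  have h : IsPolyCoeff (invSeries ^ 2 - invSeries) := by
    -- The coefficient sum runs one term further than the one in `W n`; the extra term `k = n - 1`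
    -- contributes exactly `n` after normalisation.
    refine ⟨MvPolynomial.X 0 + MvPolynomial.X 1, fun n hn => ?_⟩
    rw [coeff_invSeries_sq_sub, map_add, MvPolynomial.eval_X, MvPolynomial.eval_X,
      Matrix.cons_val_zero, Matrix.cons_val_one, Matrix.cons_val_fin_one, W]
    obtain ⟨s, rfl⟩ : ∃ s, n = s + 1 := ⟨n - 1, by omega⟩
    rw [sum_range_succ, Nat.add_sub_cancel, Nat.factorial_succ]
    have h1 : (s.factorial : ℚ) ≠ 0 := by positivity
    have h2 : ((s + 1 : ℕ) : ℚ) ^ s ≠ 0 := by positivity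
    rw [Nat.cast_mul]
    field_simp
    ring
  simpa using h.add isPolyCoeff_invSeries

lemma isPolyCoeff_invSeries_pow (k : ℕ) : IsPolyCoeff (invSeries ^ k) := by
  suffices h : ∀ k, IsPolyCoeff (invSeries ^ (k + 1)) ∧ IsPolyCoeff (invSeries ^ (k + 2)) by
    rcases k with _ | k
    · simpa using isPolyCoeff_one
    · exact (h k).1
  intro k
  induction k with
  | zero => exact ⟨by simpa using isPolyCoeff_invSeries, isPolyCoeff_invSeries_sq⟩
  | succ k ih =>
    refine ⟨ih.2, ?_⟩
    have h : invSeries ^ (k + 1 + 2) =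
        (1 / ((k + 1 : ℕ) : ℚ)) • RootedLabeledTree.euler ℚ (invSeries ^ (k + 1)) +
          invSeries ^ (k + 2) := by
      rw [Derivation.leibniz_pow, euler_invSeries, add_tsub_cancel_right,
        ← Nat.cast_smul_eq_nsmul ℚ, smul_smul, one_div, inv_mul_cancel₀ (by positivity), one_smul,
        smul_eq_mul]
      ring
    rw [h]
    exact (ih.1.euler.smul _).add ih.2

/-- The algebra of polynomials in `1 / (1 - T)`. -/
noncomputable def invAlgebra : Subalgebra ℚ ℚ⟦X⟧ := Algebra.adjoin ℚ {invSeries}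

lemma invSeries_mem : invSeries ∈ invAlgebra := Algebra.subset_adjoin rfl

lemma isPolyCoeff_of_mem {f : ℚ⟦X⟧} (hf : f ∈ invAlgebra) : IsPolyCoeff f := by
  rw [invAlgebra, Algebra.adjoin_singleton_eq_range_aeval] at hf
  obtain ⟨p, rfl⟩ := hf
  induction p using Polynomial.induction_on' with
  | add p q hp hq =>
    simp only [AlgHom.toRingHom_eq_coe, RingHom.coe_coe, map_add] at *
    exact hp.add hq
  | monomial n a =>
    simp only [AlgHom.toRingHom_eq_coe, RingHom.coe_coe, Polynomial.aeval_monomial]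
    rw [← Algebra.smul_def]
    exact (isPolyCoeff_invSeries_pow n).smul a

lemma euler_mem {f : ℚ⟦X⟧} (hf : f ∈ invAlgebra) : euler ℚ f ∈ invAlgebra := by
  induction hf using Algebra.adjoin_induction with
  | mem x hx =>
    rw [Set.mem_singleton_iff.1 hx, euler_invSeries]
    exact sub_mem (pow_mem invSeries_mem 3) (pow_mem invSeries_mem 2)
  | algebraMap c =>
    rw [Derivation.map_algebraMap]
    exact zero_mem _
  | add f g hf hg hf' hg' =>
    rw [map_add]
    exact add_mem hf' hg'
  | mul f g hf hg hf' hg' =>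
    rw [Derivation.leibniz, smul_eq_mul, smul_eq_mul]
    exact add_mem (mul_mem hf hg') (mul_mem hg hf')

lemma euler_cayleySeries_mem : euler ℚ cayleySeries ∈ invAlgebra := by
  rw [euler_cayleySeries_eq]
  exact sub_mem invSeries_mem (one_mem _)

/-- The operator multiplying the `n`-th coefficient by `n.choose i`. -/
noncomputable def chooseOp (i : ℕ) (f : ℚ⟦X⟧) : ℚ⟦X⟧ :=
  PowerSeries.mk fun n => (n.choose i : ℚ) * coeff n f

lemma chooseOp_zero (f : ℚ⟦X⟧) : chooseOp 0 f = f := by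
  ext n
  simp [chooseOp]

/-- On coefficients, (i + 2) C(n, i + 2) = (n - (i + 1)) C(n, i + 1), so θ builds these operators
recursively. Only θf is required to lie in ℚ[u], because the case f = T = 1 - 1/u is needed and T is
not a polynomial in u. -/
lemma chooseOp_mem {f : ℚ⟦X⟧} (hf : euler ℚ f ∈ invAlgebra) (i : ℕ) :
    chooseOp (i + 1) f ∈ invAlgebra := by
  induction i with
  | zero =>
    convert! hf
    ext n
    simp [chooseOp]
  | succ i ih =>
    have h : chooseOp (i + 1 + 1) f = (1 / ((i + 1 + 1 : ℕ) : ℚ)) •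
        (euler ℚ (chooseOp (i + 1) f) - ((i + 1 : ℕ) : ℚ) • chooseOp (i + 1) f) := by
      ext n
      rw [map_smul, map_sub, map_smul, coeff_euler, chooseOp, chooseOp, coeff_mk, coeff_mk,
        smul_eq_mul, smul_eq_mul]
      have hc : (n.choose (i + 1 + 1) : ℚ) * (i + 1 + 1 : ℕ) =
          n.choose (i + 1) * ((n : ℚ) - (i + 1 : ℕ)) := by
        rcases le_or_gt (i + 1) n with hle | hlt
        · rw [← Nat.cast_sub hle]
          exact_mod_cast Nat.choose_succ_right_eq n (i + 1)
        · rw [Nat.choose_eq_zero_of_lt hlt, Nat.choose_eq_zero_of_lt (by omega)]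
          simp
      have h0 : ((i + 1 + 1 : ℕ) : ℚ) ≠ 0 := by positivity
      rw [one_div, ← mul_right_inj' h0, mul_inv_cancel_left₀ h0]
      linear_combination coeff n f * hc
    rw [h]
    exact Subalgebra.smul_mem _ (sub_mem (euler_mem ih) (Subalgebra.smul_mem _ ih _)) _

end Good

/-! ### Expansion around y = 1 -/

section Expansion

/-- The part of degree `r` in the coefficients. -/
noncomputable def component (r : ℕ) (f : (Polynomial ℚ)⟦X⟧) : ℚ⟦X⟧ :=
  PowerSeries.mk fun n => (coeff n f).coeff r

lemma component_mul (r : ℕ) (f g : (Polynomial ℚ)⟦X⟧) :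
    component r (f * g) = ∑ p ∈ antidiagonal r, component p.1 f * component p.2 g := by
  ext n
  rw [component, coeff_mk, coeff_mul, Polynomial.finsetSum_coeff, map_sum]
  simp only [Polynomial.coeff_mul, coeff_mul, component, coeff_mk]
  exact sum_comm

lemma component_coeffDerivation (r : ℕ) (f : (Polynomial ℚ)⟦X⟧) :
    component r (coeffDerivation Polynomial.derivative' f) =
      ((r + 1 : ℕ) : ℚ) • component (r + 1) f := by
  ext n
  rw [component, coeff_mk, coeff_coeffDerivation, map_smul, component, coeff_mk, smul_eq_mul]
  change (Polynomial.derivative (coeff n f)).coeff r = _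
  rw [Polynomial.coeff_derivative]
  push_cast
  ring

lemma component_rescale (r : ℕ) (f : (Polynomial ℚ)⟦X⟧) :
    component r (rescale (1 + Polynomial.X) f) =
      ∑ p ∈ antidiagonal r, chooseOp p.1 (component p.2 f) := by
  ext n
  rw [component, coeff_mk, coeff_rescale, Polynomial.coeff_mul, map_sum]
  refine sum_congr rfl fun p _ => ?_
  rw [Polynomial.coeff_one_add_X_pow, chooseOp, coeff_mk, component, coeff_mk]

/-- The exponential generating function of the binomial moments of the total height. -/
noncomputable def heightSeries (r : ℕ) : ℚ⟦X⟧ :=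
  component r (treeSeries (1 + Polynomial.X : Polynomial ℚ))

lemma coeff_heightSeries (r n : ℕ) : (n.factorial : ℚ) * coeff n (heightSeries r) =
    ∑ T : RootedLabeledTree n, (T.totalHeight.choose r : ℚ) := by
  rw [heightSeries, component, coeff_mk, treeSeries, coeff_mk, ← Algebra.smul_def,
    Polynomial.coeff_smul, smul_eq_mul, ← mul_assoc, mul_one_div_cancel (by positivity), one_mul,
    Polynomial.finsetSum_coeff]
  simp only [Polynomial.coeff_one_add_X_pow]

lemma heightSeries_zero : heightSeries 0 = cayleySeries := by
  ext n
  have h : (n.factorial : ℚ) ≠ 0 := by positivity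
  rw [← mul_right_inj' h, coeff_heightSeries, cayleySeries, treeSeries, coeff_mk,
    Algebra.algebraMap_self, RingHom.id_apply, ← mul_assoc, mul_one_div_cancel h]
  simp

/-- The series of binomial moments of total height plus number of vertices. -/
noncomputable def shiftedHeightSeries (r : ℕ) : ℚ⟦X⟧ :=
  ∑ p ∈ antidiagonal r, chooseOp p.1 (heightSeries p.2)

/-- Coefficient of q^r in ∂T = T · ∂(T(xy, y)), where ∂ = d/dq and y = 1 + q. -/
lemma heightSeries_succ (r : ℕ) : ((r + 1 : ℕ) : ℚ) • heightSeries (r + 1) =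
    ∑ p ∈ antidiagonal r,
      heightSeries p.1 * (((p.2 + 1 : ℕ) : ℚ) • shiftedHeightSeries (p.2 + 1)) := by
  rw [heightSeries, ← component_coeffDerivation, coeffDerivation_treeSeries, component_mul]
  refine sum_congr rfl fun p _ => ?_
  rw [component_coeffDerivation, component_rescale]
  rfl

lemma shiftedHeightSeries_sub_mem (r : ℕ)
    (h : ∀ k, 1 ≤ k → k < r → heightSeries k ∈ invAlgebra) :
    shiftedHeightSeries r - heightSeries r ∈ invAlgebra := by
  rcases r with _ | r
  · simp [shiftedHeightSeries, chooseOp_zero, zero_mem]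
  · rw [shiftedHeightSeries, Finset.Nat.sum_antidiagonal_succ, chooseOp_zero, add_sub_cancel_left]
    refine sum_mem fun p hp => chooseOp_mem ?_ _
    rw [HasAntidiagonal.mem_antidiagonal] at hp
    rcases Nat.eq_zero_or_pos p.2 with h0 | h0
    · rw [h0, heightSeries_zero]
      exact euler_cayleySeries_mem
    · exact euler_mem (h _ h0 (by omega))

lemma heightSeries_mem (r : ℕ) : heightSeries (r + 1) ∈ invAlgebra := by
  induction r using Nat.strong_induction_on with
  | _ r ih =>
    have hmem : ∀ k, 1 ≤ k → k < r + 1 → heightSeries k ∈ invAlgebra := by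
      intro k h1 h2
      obtain ⟨i, rfl⟩ : ∃ i, k = i + 1 := ⟨k - 1, by omega⟩
      exact ih i (by omega)
    have ha := shiftedHeightSeries_sub_mem (r + 1) hmem
    set a := shiftedHeightSeries (r + 1) - heightSeries (r + 1) with ha'
    -- Only the term with first index zero involves the unknown H_{r+1}; it also carries the only
    -- bare factor T.
    have hsplit : ∃ b ∈ invAlgebra, ((r + 1 : ℕ) : ℚ) • heightSeries (r + 1) =
        cayleySeries * (((r + 1 : ℕ) : ℚ) • (heightSeries (r + 1) + a)) + b := by
      rw [heightSeries_succ]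
      have h0 : ((0, r) : ℕ × ℕ) ∈ antidiagonal r := by simp
      rw [← add_sum_erase _ _ h0, heightSeries_zero, ha', add_sub_cancel]
      refine ⟨_, sum_mem fun p hp => ?_, rfl⟩
      obtain ⟨hne, hp⟩ := mem_erase.1 hp
      rw [HasAntidiagonal.mem_antidiagonal] at hp
      have hp1 : 1 ≤ p.1 := by
        by_contra hlt
        exact hne (Prod.ext (by simp; omega) (by simp; omega))
      refine mul_mem (hmem _ hp1 (by omega)) (Subalgebra.smul_mem _ ?_ _)
      have h2 := shiftedHeightSeries_sub_mem (p.2 + 1) fun k h1 h2 => hmem k h1 (by omega)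
      simpa using add_mem h2 (hmem (p.2 + 1) (by omega) (by omega))
    obtain ⟨b, hb, hab⟩ := hsplit
    have hr : ((r + 1 : ℕ) : ℚ) ≠ 0 := by positivity
    -- Solving (1 - T)H_{r+1} = T a + b/(r + 1) multiplies by u, and uT = u - 1 brings the stray T
    -- back into ℚ[u].
    have key : heightSeries (r + 1) =
        (invSeries - 1) * a + (1 / ((r + 1 : ℕ) : ℚ)) • (invSeries * b) := by
      have hab' : heightSeries (r + 1) = cayleySeries * (heightSeries (r + 1) + a) +
          (1 / ((r + 1 : ℕ) : ℚ)) • b := by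
        have h := congrArg (((r + 1 : ℕ) : ℚ)⁻¹ • ·) hab
        simp only [smul_add, mul_smul_comm, mul_add, inv_smul_smul₀ hr] at h
        rw [one_div, mul_add]
        exact h
      rw [← mul_smul_comm]
      linear_combination invSeries * hab' -
        (heightSeries (r + 1) + a) * one_sub_mul_invSeries
    rw [key]
    exact add_mem (mul_mem (sub_mem invSeries_mem (one_mem _)) ha)
      (Subalgebra.smul_mem _ (mul_mem invSeries_mem hb) _)

lemma isPolyCoeff_heightSeries (r : ℕ) : IsPolyCoeff (heightSeries r) := by
  rcases r with _ | r
  · rw [heightSeries_zero]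
    exact isPolyCoeff_cayleySeries
  · exact isPolyCoeff_of_mem (heightSeries_mem r)

end Expansion

/-! ### From factorial moments to all moments -/

section Moments

/-- Sums of `r`-th falling factorials of the total height. -/
lemma exists_sum_descFactorial (r : ℕ) : ∃ P : MvPolynomial (Fin 2) ℚ, ∀ n : ℕ, 1 ≤ n →
    ∑ T : RootedLabeledTree n, (T.totalHeight.descFactorial r : ℚ) =
      (n : ℚ) ^ (n - 1) * MvPolynomial.eval ![(n : ℚ), W n] P := by
  obtain ⟨P, hP⟩ := (isPolyCoeff_heightSeries r).smul r.factorial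
  refine ⟨P, fun n hn => ?_⟩
  rw [← hP n hn, map_smul, smul_eq_mul, mul_left_comm, coeff_heightSeries, mul_sum]
  refine sum_congr rfl fun T _ => ?_
  rw [Nat.descFactorial_eq_factorial_mul_choose, Nat.cast_mul]

lemma iterate_derivative_weightEnumerator (n r : ℕ) :
    (Polynomial.derivative^[r] (weightEnumerator n)).eval 1 =
      ∑ T : RootedLabeledTree n, (T.totalHeight.descFactorial r : ℚ) := by
  rw [weightEnumerator, Polynomial.iterate_derivative_sum, Polynomial.eval_finsetSum]
  refine sum_congr rfl fun T _ => ?_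
  rw [Polynomial.iterate_derivative_X_pow_eq_natCast_mul]
  simp

lemma expectation_add (n : ℕ) (f g : RootedLabeledTree n → ℚ) :
    expectation n (fun T => f T + g T) = expectation n f + expectation n g := by
  rw [expectation, expectation, expectation, sum_add_distrib, add_div]

lemma expectation_mul_left (n : ℕ) (c : ℚ) (f : RootedLabeledTree n → ℚ) :
    expectation n (fun T => c * f T) = c * expectation n f := by
  rw [expectation, expectation, ← mul_sum, mul_div_assoc]

lemma expectation_sum {ι : Type*} (s : Finset ι) (n : ℕ) (f : ι → RootedLabeledTree n → ℚ) :
    expectation n (fun T => ∑ i ∈ s, f i T) = ∑ i ∈ s, expectation n (f i) := by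
  simp only [expectation]
  rw [sum_comm, sum_div]

lemma expectation_eq_of_sum_eq {n : ℕ} (hn : 1 ≤ n) {f : RootedLabeledTree n → ℚ} {c : ℚ}
    (h : ∑ T, f T = (n : ℚ) ^ (n - 1) * c) : expectation n f = c := by
  have hn0 : (n : ℚ) ^ (n - 1) ≠ 0 := by positivity
  rw [expectation, h, card_eq hn, mul_div_cancel_left₀ _ hn0]

/-- Writing (H)_k for the falling factorial, H · (H)_k = (H)_{k+1} + k (H)_k trades one power of H
for falling factorials. The extra factor (H)_k keeps the induction closed. -/
lemma exists_expectation_pow_mul_descFactorial (r : ℕ) :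
    ∀ k : ℕ, ∃ P : MvPolynomial (Fin 2) ℚ, ∀ n : ℕ, 1 ≤ n →
      expectation n (fun T => (T.totalHeight : ℚ) ^ r * T.totalHeight.descFactorial k) =
        MvPolynomial.eval ![(n : ℚ), W n] P := by
  induction r with
  | zero =>
    intro k
    obtain ⟨P, hP⟩ := exists_sum_descFactorial k
    refine ⟨P, fun n hn => expectation_eq_of_sum_eq hn ?_⟩
    simpa using hP n hn
  | succ r ih =>
    intro k
    obtain ⟨P, hP⟩ := ih (k + 1)
    obtain ⟨Q, hQ⟩ := ih k
    refine ⟨P + MvPolynomial.C (k : ℚ) * Q, fun n hn => ?_⟩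
    rw [map_add, map_mul, MvPolynomial.eval_C, ← hP n hn, ← hQ n hn, ← expectation_mul_left,
      ← expectation_add]
    congr 1
    funext T
    have h : (T.totalHeight.descFactorial (k + 1) : ℚ) =
        ((T.totalHeight : ℚ) - k) * T.totalHeight.descFactorial k := by
      rw [Nat.descFactorial_succ, Nat.cast_mul]
      rcases le_or_gt k T.totalHeight with hle | hlt
      · rw [Nat.cast_sub hle]
      · rw [Nat.descFactorial_eq_zero_iff_lt.2 hlt]
        simp
    rw [h]
    ring

lemma exists_moment (r : ℕ) : ∃ P : MvPolynomial (Fin 2) ℚ, ∀ n : ℕ, 1 ≤ n →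
    moment n r = MvPolynomial.eval ![(n : ℚ), W n] P := by
  obtain ⟨P, hP⟩ := exists_expectation_pow_mul_descFactorial r 0
  exact ⟨P, fun n hn => by simpa [moment] using hP n hn⟩

/-- The mean is itself a polynomial in n and W_n, so the binomial expansion about it stays
polynomial. -/
lemma exists_centralMoment (r : ℕ) : ∃ P : MvPolynomial (Fin 2) ℚ, ∀ n : ℕ, 1 ≤ n →
    centralMoment n r = MvPolynomial.eval ![(n : ℚ), W n] P := by
  choose P hP using exists_moment
  refine ⟨∑ k ∈ range (r + 1), (-P 1) ^ (r - k) * MvPolynomial.C (r.choose k : ℚ) * P k,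
    fun n hn => ?_⟩
  rw [map_sum]
  simp only [map_mul, map_pow, map_neg, MvPolynomial.eval_C, ← hP _ n hn]
  rw [centralMoment]
  simp only [sub_eq_add_neg, add_pow]
  rw [expectation_sum]
  refine sum_congr rfl fun k _ => ?_
  rw [moment.eq_def n k, ← expectation_mul_left]
  congr 1
  funext T
  ring

end Moments

end RootedLabeledTree

theorem mainTheorem6 (r : ℕ) :
    (∃ P : MvPolynomial (Fin 2) ℚ, ∀ n : ℕ, 1 ≤ n →
      RootedLabeledTree.moment n r =
        MvPolynomial.eval ![(n : ℚ), RootedLabeledTree.W n] P) ∧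
    (∃ P : MvPolynomial (Fin 2) ℚ, ∀ n : ℕ, 1 ≤ n →
      RootedLabeledTree.factorialMoment n r =
        MvPolynomial.eval ![(n : ℚ), RootedLabeledTree.W n] P ∧
      (Polynomial.derivative^[r] (RootedLabeledTree.weightEnumerator n)).eval 1 =
        (n : ℚ) ^ (n - 1) * MvPolynomial.eval ![(n : ℚ), RootedLabeledTree.W n] P) ∧
    (∃ P : MvPolynomial (Fin 2) ℚ, ∀ n : ℕ, 1 ≤ n →
      RootedLabeledTree.centralMoment n r =
        MvPolynomial.eval ![(n : ℚ), RootedLabeledTree.W n] P) := by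
  refine ⟨RootedLabeledTree.exists_moment r, ?_, RootedLabeledTree.exists_centralMoment r⟩
  obtain ⟨P, hP⟩ := RootedLabeledTree.exists_sum_descFactorial r
  refine ⟨P, fun n hn => ⟨RootedLabeledTree.expectation_eq_of_sum_eq hn (hP n hn), ?_⟩⟩
  rw [RootedLabeledTree.iterate_derivative_weightEnumerator, hP n hn]
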